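/- Conventions. A reflexive pair is a pair of parallel morphisms with a common section. A polyad $T=(D,\mathcal C,T,\mu,\eta)$ consists of a category $D$, categories $\mathcal C_i$ ($i\in \mathrm{Ob}\,D$), functors $T_a:\mathcal C_j\to\mathcal C_i$ ($a:j\to i$ in $D$), and natural transformations $\mu_{a,b}:T_aT_b\to T_{ab}$ (for composable $a,b$) and $\eta_i:\mathrm{id}_{\mathcal C_i}\to T_i:=T_{\mathrm{id}_i}$ satisfying the associativity and unit axioms $\mu_{ab,c}(\mu_{a,b}T_c)=\mu_{a,bc}(T_a\mu_{b,c})$ and $\mu_{a,\mathrm{id}_j}(T_a\eta_j)=\mathrm{id}_{T_a}=\mu_{\mathrm{id}_i,a}(\eta_iT_a)$. It is comonoidal if each $\mathcal C_i$ is a monoidal category, each $T_a$ is a comonoidal (opmonoidal) functor, with structure maps $T_a^2(X,Y):T_a(X\otimes Y)\to T_aX\otimes T_aY$ and $T_a^0:T_a\mathbf 1\to\mathbf 1$, and all $\mu_{a,b}$, $\eta_i$ are comonoidal natural transformations. A comonoidal polyad is r-exact if each $\mathcal C_i$ has coequalizers of reflexive pairs, and these are preserved by all functors $T_a$ and by the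 functors $X\otimes ?$ and $?\otimes X$ for every object $X$ of every $\mathcal C_i$. A comonoidal polyad is left Hopf if for all $k\xrightarrow{b}j\xrightarrow{a}i$ in $D$ and all objects $X$ of $\mathcal C_j$, $Y$ of $\mathcal C_k$ the left fusion operator $$H^l_{a,b}(X,Y)=(T_aX\otimes(\mu_{a,b})_Y)\,T_a^2(X,T_bY):T_a(X\otimes T_bY)\to T_aX\otimes T_{ab}Y$$ is an isomorphism; it is right Hopf if the right fusion operator $$H^r_{a,b}(Y,X)=((\mu_{a,b})_Y\otimes T_aX)\,T_a^2(T_bY,X):T_a(T_bY\otimes X)\to T_{ab}Y\otimes T_aX$$ is always an isomorphism, and Hopf if it is both left and right Hopf. The lift $\tilde T=(D,\tilde{\mathcal C},\tilde T,\tilde\mu,\tilde\eta)$ of an r-exact comonoidal polyad $T$ is the following comonoidal polyad. The category $\tilde{\mathcal C}_i$ is the category of modules over the comonoidal monad $(T_i,\mu_{\mathrm{id}_i,\mathrm{id}_i},\eta_i)$, with tensor product $(M,r)\otimes(N,s)=(M\otimes N,(r\otimes s)T_i^2(M,N))$ and unit $(\mathbf 1,T_i^0)$. For $a:j\to i$ and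 a $T_j$-module $(M,r)$, $\tilde T_a(M,r)=T_a\odot_{T_j}M$ is the coequalizer $\pi_a:T_aM\to\tilde T_a(M,r)$ of $(\mu_{a,\mathrm{id}_j})_M,\ T_a(r):T_aT_jM\rightrightarrows T_aM$, with the $T_i$-action induced by $\mu_{\mathrm{id}_i,a}$. The transformations $\tilde\mu_{a,b}$, $\tilde T_a^2$, $\tilde T_a^0$ are induced on these quotients by $\mu_{a,b}$, $T_a^2$, $T_a^0$, and $\tilde\eta_i$ at $(M,r)$ is $\pi_{\mathrm{id}_i}\circ(\eta_i)_M$. Theorem. Let $T$ be an r-exact comonoidal polyad. If $T$ is a left Hopf (resp. right Hopf, resp. Hopf) polyad, then its lift $\tilde T$ is an r-exact left Hopf (resp. right Hopf, resp. Hopf) polyad. -/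

import Mathlib

open CategoryTheory Limits MonoidalCategory

universe v u v' u'

set_option linter.checkUnivs false

/-- A polyad with source `D`: categories `C i`, functors `T a : C j ⥤ C i` for `a : j ⟶ i`,
natural transformations `μ_{a,b} : T_a T_b ⟶ T_{ab}` (`ab` is `b ≫ a`, first `b`, then `a`)
and `η_i : id ⟶ T_{id_i}`, which are associative and unital.  The composite is passed to `μ`
as a morphism `c` with a proof of `b ≫ a = c`; this is the same datum as `μ_{a,b}` with values
in `T (b ≫ a)`, and makes the axioms meaningful without transport along equalities such as
`𝟙 j ≫ a = a`. -/
structure Polyad (D : Type u) [Category.{v} D] where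
  C : D → Type u'
  [cat : ∀ i, Category.{v'} (C i)]
  T : ∀ {j i : D}, (j ⟶ i) → C j ⥤ C i
  μ : ∀ {k j i : D} (a : j ⟶ i) (b : k ⟶ j) (c : k ⟶ i), b ≫ a = c → (T b ⋙ T a ⟶ T c)
  η : ∀ i : D, 𝟭 (C i) ⟶ T (𝟙 i)
  μ_assoc : ∀ {l k j i : D} (a : j ⟶ i) (b : k ⟶ j) (c : l ⟶ k) (ab : k ⟶ i) (bc : l ⟶ j)
    (abc : l ⟶ i) (h₁ : b ≫ a = ab) (h₂ : c ≫ b = bc) (h₃ : c ≫ ab = abc) (h₄ : bc ≫ a = abc)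
    (X : C l),
    (μ a b ab h₁).app ((T c).obj X) ≫ (μ ab c abc h₃).app X =
      (T a).map ((μ b c bc h₂).app X) ≫ (μ a bc abc h₄).app X
  μ_right_unit : ∀ {j i : D} (a : j ⟶ i) (X : C j),
    (T a).map ((η j).app X) ≫ (μ a (𝟙 j) a (Category.id_comp a)).app X = 𝟙 _
  μ_left_unit : ∀ {j i : D} (a : j ⟶ i) (X : C j),
    (η i).app ((T a).obj X) ≫ (μ (𝟙 i) a a (Category.comp_id a)).app X = 𝟙 _

attribute [instance] Polyad.cat

namespace Polyad
variable {D : Type u} [Category.{v} D]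

theorem μ_assoc_assoc (P : Polyad.{v, u, v', u'} D) {l k j i : D} (a : j ⟶ i) (b : k ⟶ j)
    (c : l ⟶ k) (ab : k ⟶ i) (bc : l ⟶ j) (abc : l ⟶ i) (h₁ : b ≫ a = ab) (h₂ : c ≫ b = bc)
    (h₃ : c ≫ ab = abc) (h₄ : bc ≫ a = abc) (X : P.C l) {Z : P.C i}
    (f : (P.T abc).obj X ⟶ Z) :
    (P.μ a b ab h₁).app ((P.T c).obj X) ≫ (P.μ ab c abc h₃).app X ≫ f =
      (P.T a).map ((P.μ b c bc h₂).app X) ≫ (P.μ a bc abc h₄).app X ≫ f := by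
  simpa only [Category.assoc, Category.id_comp] using
    eq_whisker (P.μ_assoc a b c ab bc abc h₁ h₂ h₃ h₄ X) f

theorem μ_right_unit_assoc (P : Polyad.{v, u, v', u'} D) {j i : D} (a : j ⟶ i) (X : P.C j)
    {Z : P.C i} (f : (P.T a).obj X ⟶ Z) :
    (P.T a).map ((P.η j).app X) ≫ (P.μ a (𝟙 j) a (Category.id_comp a)).app X ≫ f = f := by
  simpa only [Category.assoc, Category.id_comp] using
    eq_whisker (P.μ_right_unit a X) f

theorem μ_left_unit_assoc (P : Polyad.{v, u, v', u'} D) {j i : D} (a : j ⟶ i) (X : P.C j)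
    {Z : P.C i} (f : (P.T a).obj X ⟶ Z) :
    (P.η i).app ((P.T a).obj X) ≫ (P.μ (𝟙 i) a a (Category.comp_id a)).app X ≫ f = f := by
  simpa only [Category.assoc, Category.id_comp] using
    eq_whisker (P.μ_left_unit a X) f

/-- An r-exact polyad: the categories `C i` have coequalizers of reflexive pairs and the
functors `T a` preserve them. -/
class IsRExact (P : Polyad.{v, u, v', u'} D) : Prop where
  hasReflexiveCoequalizers : ∀ i : D, HasReflexiveCoequalizers (P.C i)
  preserves : ∀ {j i : D} (a : j ⟶ i), Monad.PreservesColimitOfIsReflexivePair (P.T a)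

attribute [instance] IsRExact.hasReflexiveCoequalizers IsRExact.preserves

/-- The monad `T_i = T_{id_i}` on `C i`. -/
@[reducible]
def monad (P : Polyad.{v, u, v', u'} D) (i : D) : Monad (P.C i) where
  toFunctor := P.T (𝟙 i)
  η := P.η i
  μ := P.μ (𝟙 i) (𝟙 i) (𝟙 i) (Category.comp_id _)
  assoc X := (P.μ_assoc _ _ _ _ _ _ _ _ _ _ X).symm
  left_unit X := P.μ_left_unit (𝟙 i) X
  right_unit X := P.μ_right_unit (𝟙 i) X

variable (P : Polyad.{v, u, v', u'} D)

/-- The category of modules over the monad `T_i`. -/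
abbrev Mod (i : D) := (P.monad i).Algebra

variable {P}

theorem act_assoc {i : D} (M : P.Mod i) :
    (P.μ (𝟙 i) (𝟙 i) (𝟙 i) (Category.comp_id _)).app M.A ≫ M.a =
      (P.T (𝟙 i)).map M.a ≫ M.a := M.assoc

theorem act_unit {i : D} (M : P.Mod i) : (P.η i).app M.A ≫ M.a = 𝟙 M.A := M.unit

theorem act_hom {i : D} {M N : P.Mod i} (f : M ⟶ N) :
    (P.T (𝟙 i)).map f.f ≫ N.a = M.a ≫ f.f := f.h

theorem μ_nat {k j i : D} (a : j ⟶ i) (b : k ⟶ j) (c : k ⟶ i) (h : b ≫ a = c)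
    {X Y : P.C k} (f : X ⟶ Y) :
    (P.T a).map ((P.T b).map f) ≫ (P.μ a b c h).app Y = (P.μ a b c h).app X ≫ (P.T c).map f :=
  (P.μ a b c h).naturality f

theorem μ_nat_assoc {k j i : D} (a : j ⟶ i) (b : k ⟶ j) (c : k ⟶ i) (h : b ≫ a = c)
    {X Y : P.C k} (g : X ⟶ Y) {Z : P.C i} (f : (P.T c).obj Y ⟶ Z) :
    (P.T a).map ((P.T b).map g) ≫ (P.μ a b c h).app Y ≫ f =
      (P.μ a b c h).app X ≫ (P.T c).map g ≫ f := by
  simpa only [Category.assoc, Category.id_comp] using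
    eq_whisker (μ_nat a b c h g) f

theorem η_nat (i : D) {X Y : P.C i} (f : X ⟶ Y) :
    f ≫ (P.η i).app Y = (P.η i).app X ≫ (P.T (𝟙 i)).map f :=
  (P.η i).naturality f

theorem η_nat_assoc (i : D) {X Y : P.C i} (g : X ⟶ Y) {Z : P.C i}
    (f : (P.T (𝟙 i)).obj Y ⟶ Z) :
    g ≫ (P.η i).app Y ≫ f = (P.η i).app X ≫ (P.T (𝟙 i)).map g ≫ f := by
  simpa only [Category.assoc, Category.id_comp] using
    eq_whisker (η_nat i g) f

/-- `T_a` applied to the action of the `T_j`-module `M`: `T_a T_j M ⟶ T_a M`. -/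
abbrev actL {j i : D} (a : j ⟶ i) (M : P.Mod j) :
    (P.T a).obj ((P.T (𝟙 j)).obj M.A) ⟶ (P.T a).obj M.A :=
  (P.T a).map M.a

/-- The right action of `T_j` on `T_a`, evaluated at `M`: `T_a T_j M ⟶ T_a M`. -/
abbrev actR {j i : D} (a : j ⟶ i) (M : P.Mod j) :
    (P.T a).obj ((P.T (𝟙 j)).obj M.A) ⟶ (P.T a).obj M.A :=
  (P.μ a (𝟙 j) a (Category.id_comp a)).app M.A

instance {j i : D} (a : j ⟶ i) (M : P.Mod j) : IsReflexivePair (actR a M) (actL a M) :=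
  IsReflexivePair.mk' ((P.T a).map ((P.η j).app M.A)) (P.μ_right_unit a M.A)
    (by rw [actL, ← Functor.map_comp, act_unit, CategoryTheory.Functor.map_id])

variable [P.IsRExact]

/-- The object `T_a ⊙_{T_j} M`, the coequalizer of the reflexive pair `T_a T_j M ⇉ T_a M` formed
by the right action of `T_j` on `T_a` and the action of `T_j` on `M`. -/
noncomputable abbrev tensorMod {j i : D} (a : j ⟶ i) (M : P.Mod j) : P.C i :=
  coequalizer (actR a M) (actL a M)

/-- The projection `T_a M ⟶ T_a ⊙_{T_j} M`. -/
noncomputable def π {j i : D} (a : j ⟶ i) (M : P.Mod j) : (P.T a).obj M.A ⟶ tensorMod a M :=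
  coequalizer.π _ _

theorem π_condition {j i : D} (a : j ⟶ i) (M : P.Mod j) :
    (P.μ a (𝟙 j) a (Category.id_comp a)).app M.A ≫ π a M = (P.T a).map M.a ≫ π a M :=
  coequalizer.condition _ _

instance {j i : D} (a : j ⟶ i) (M : P.Mod j) : Epi (π a M) :=
  inferInstanceAs (Epi (coequalizer.π _ _))

theorem isReflexivePair_map {C₁ C₂ : Type*} [Category* C₁] [Category* C₂] (F : C₁ ⥤ C₂)
    {X Y : C₁} (f g : X ⟶ Y) [IsReflexivePair f g] : IsReflexivePair (F.map f) (F.map g) :=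
  IsReflexivePair.mk' (F.map (commonSection f g))
    (by rw [← F.map_comp, section_comp_left, F.map_id])
    (by rw [← F.map_comp, section_comp_right, F.map_id])

instance {j i i' : D} (a : j ⟶ i) (b : i ⟶ i') (M : P.Mod j) : Epi ((P.T b).map (π a M)) :=
  epi_of_isColimit_cofork
    (isColimitOfHasCoequalizerOfPreservesColimit (P.T b) (actR a M) (actL a M))

instance {j i i' i'' : D} (a : j ⟶ i) (b : i ⟶ i') (c : i' ⟶ i'') (M : P.Mod j) :
    Epi ((P.T c).map ((P.T b).map (π a M))) :=
  haveI := isReflexivePair_map (P.T b) (actR a M) (actL a M)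
  epi_of_isColimit_cofork (isColimitCoforkMapOfIsColimit (P.T c) _
    (isColimitOfHasCoequalizerOfPreservesColimit (P.T b) (actR a M) (actL a M)))

theorem tensorMod_hom_ext {j i : D} {a : j ⟶ i} {M : P.Mod j} {Z : P.C i}
    {f g : tensorMod a M ⟶ Z} (h : π a M ≫ f = π a M ≫ g) : f = g :=
  (cancel_epi (π a M)).1 h

/-- Morphisms out of `T_a ⊙_{T_j} M`. -/
noncomputable def desc {j i : D} (a : j ⟶ i) (M : P.Mod j) {Z : P.C i} (k : (P.T a).obj M.A ⟶ Z)
    (w : (P.μ a (𝟙 j) a (Category.id_comp a)).app M.A ≫ k = (P.T a).map M.a ≫ k) :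
    tensorMod a M ⟶ Z :=
  coequalizer.desc k w

@[simp]
theorem π_desc {j i : D} (a : j ⟶ i) (M : P.Mod j) {Z : P.C i} (k : (P.T a).obj M.A ⟶ Z)
    (w : (P.μ a (𝟙 j) a (Category.id_comp a)).app M.A ≫ k = (P.T a).map M.a ≫ k) :
    π a M ≫ desc a M k w = k :=
  coequalizer.π_desc _ _

/-- Morphisms out of `T_b (T_a ⊙_{T_j} M)`; the functor `T_b` preserves the coequalizer. -/
noncomputable def mapDesc {j i i' : D} (b : i ⟶ i') (a : j ⟶ i) (M : P.Mod j) {Z : P.C i'}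
    (k : (P.T b).obj ((P.T a).obj M.A) ⟶ Z)
    (w : (P.T b).map ((P.μ a (𝟙 j) a (Category.id_comp a)).app M.A) ≫ k =
      (P.T b).map ((P.T a).map M.a) ≫ k) : (P.T b).obj (tensorMod a M) ⟶ Z :=
  Cofork.IsColimit.desc
    (isColimitOfHasCoequalizerOfPreservesColimit (P.T b) (actR a M) (actL a M)) k w

@[simp]
theorem π_mapDesc {j i i' : D} (b : i ⟶ i') (a : j ⟶ i) (M : P.Mod j) {Z : P.C i'}
    (k : (P.T b).obj ((P.T a).obj M.A) ⟶ Z)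
    (w : (P.T b).map ((P.μ a (𝟙 j) a (Category.id_comp a)).app M.A) ≫ k =
      (P.T b).map ((P.T a).map M.a) ≫ k) :
    (P.T b).map (π a M) ≫ mapDesc b a M k w = k :=
  Cofork.IsColimit.π_desc
    (isColimitOfHasCoequalizerOfPreservesColimit (P.T b) (actR a M) (actL a M))

/-- The `T_i`-module `T_a ⊙_{T_j} M`; its action is induced by the left action
`μ_{id,a}` of `T_i` on `T_a`. -/
@[reducible]
noncomputable def liftObj {j i : D} (a : j ⟶ i) (M : P.Mod j) : P.Mod i where
  A := tensorMod a M
  a := mapDesc (𝟙 i) a M ((P.μ (𝟙 i) a a (Category.comp_id a)).app M.A ≫ π a M) (by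
    rw [← μ_assoc_assoc (h₁ := Category.comp_id a) (h₃ := Category.id_comp a), π_condition,
      μ_nat_assoc])
  unit := by
    change (P.η i).app _ ≫ _ = _
    rw [← cancel_epi (π a M), η_nat_assoc, π_mapDesc, μ_left_unit_assoc, Category.comp_id]
  assoc := by
    change (P.μ (𝟙 i) (𝟙 i) (𝟙 i) _).app _ ≫ _ = (P.T (𝟙 i)).map _ ≫ _
    rw [← cancel_epi ((P.T (𝟙 i)).map ((P.T (𝟙 i)).map (π a M))), μ_nat_assoc, π_mapDesc,
      ← Functor.map_comp_assoc, π_mapDesc, Functor.map_comp_assoc, π_mapDesc,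
      μ_assoc_assoc (h₄ := Category.comp_id a) (h₂ := Category.comp_id a)]

theorem π_act {j i : D} (a : j ⟶ i) (M : P.Mod j) :
    (P.T (𝟙 i)).map (π a M) ≫ (liftObj a M).a =
      (P.μ (𝟙 i) a a (Category.comp_id a)).app M.A ≫ π a M :=
  π_mapDesc ..

theorem π_act_assoc {j i : D} (a : j ⟶ i) (M : P.Mod j) {Z : P.C i} (f : tensorMod a M ⟶ Z) :
    (P.T (𝟙 i)).map (π a M) ≫ (liftObj a M).a ≫ f =
      (P.μ (𝟙 i) a a (Category.comp_id a)).app M.A ≫ π a M ≫ f := by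
  simpa only [Category.assoc, Category.id_comp] using
    eq_whisker (π_act a M) f

/-- The action of `T_a ⊙_{T_j} ?` on morphisms. -/
noncomputable def liftMap {j i : D} (a : j ⟶ i) {M N : P.Mod j} (f : M ⟶ N) :
    liftObj a M ⟶ liftObj a N where
  f := desc a M ((P.T a).map f.f ≫ π a N) (by
    rw [← μ_nat_assoc, π_condition, ← Functor.map_comp_assoc, ← Functor.map_comp_assoc, act_hom])
  h := by
    change (P.T (𝟙 i)).map _ ≫ _ = _
    rw [← cancel_epi ((P.T (𝟙 i)).map (π a M)), ← Functor.map_comp_assoc, π_act_assoc]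
    rw [π_desc]
    rw [Functor.map_comp_assoc, π_act, μ_nat_assoc]

@[simp]
theorem π_liftMap {j i : D} (a : j ⟶ i) {M N : P.Mod j} (f : M ⟶ N) :
    π a M ≫ (liftMap a f).f = (P.T a).map f.f ≫ π a N :=
  π_desc ..

theorem π_liftMap_assoc {j i : D} (a : j ⟶ i) {M N : P.Mod j} (g : M ⟶ N) {Z : P.C i}
    (f : tensorMod a N ⟶ Z) :
    π a M ≫ (liftMap a g).f ≫ f = (P.T a).map g.f ≫ π a N ≫ f := by
  simpa only [Category.assoc, Category.id_comp] using
    eq_whisker (π_liftMap a g) f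

/-- The functor `T_a ⊙_{T_j} ?` from `T_j`-modules to `T_i`-modules. -/
@[reducible]
noncomputable def liftFunctor {j i : D} (a : j ⟶ i) : P.Mod j ⥤ P.Mod i where
  obj := liftObj a
  map := liftMap a
  map_id M := by
    apply Monad.Algebra.Hom.ext'
    refine tensorMod_hom_ext ?_
    rw [π_liftMap]
    simp
  map_comp f g := by
    apply Monad.Algebra.Hom.ext'
    refine tensorMod_hom_ext ?_
    rw [π_liftMap]
    change _ = π a _ ≫ (liftMap a f).f ≫ (liftMap a g).f
    rw [π_liftMap_assoc, π_liftMap, ← Functor.map_comp_assoc]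
    rfl

/-- The unit of the lift, induced by `η_i`: the composite `M ⟶ T_i M ⟶ T_i ⊙_{T_i} M`. -/
noncomputable def liftη (i : D) : 𝟭 (P.Mod i) ⟶ liftFunctor (P := P) (𝟙 i) where
  app M :=
    { f := (P.η i).app M.A ≫ π (𝟙 i) M
      h := by
        change (P.T (𝟙 i)).map _ ≫ _ = M.a ≫ _
        rw [Functor.map_comp_assoc, π_act, η_nat_assoc, ← π_condition,
          μ_left_unit_assoc, μ_right_unit_assoc] }
  naturality M N f := by
    apply Monad.Algebra.Hom.ext'
    change f.f ≫ _ ≫ _ = (_ ≫ _) ≫ _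
    rw [Category.assoc, π_liftMap, η_nat_assoc]

theorem liftη_app_f (i : D) (M : P.Mod i) :
    ((liftη i).app M).f = (P.η i).app M.A ≫ π (𝟙 i) M := rfl

/-- The morphism `T_a (T_b ⊙ M) ⟶ T_{ab} ⊙ M` induced by `μ_{a,b}`. -/
noncomputable def preLiftμ {k j i : D} (a : j ⟶ i) (b : k ⟶ j) (c : k ⟶ i) (h : b ≫ a = c)
    (M : P.Mod k) : (P.T a).obj (tensorMod b M) ⟶ tensorMod c M :=
  mapDesc a b M ((P.μ a b c h).app M.A ≫ π c M) (by
    rw [← μ_assoc_assoc (h₁ := h) (h₃ := Category.id_comp c), π_condition, μ_nat_assoc])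

theorem π_preLiftμ {k j i : D} (a : j ⟶ i) (b : k ⟶ j) (c : k ⟶ i) (h : b ≫ a = c)
    (M : P.Mod k) :
    (P.T a).map (π b M) ≫ preLiftμ a b c h M = (P.μ a b c h).app M.A ≫ π c M :=
  π_mapDesc ..

/-- The morphism `T_a ⊙ (T_b ⊙ M) ⟶ T_{ab} ⊙ M` induced by `μ_{a,b}`. -/
noncomputable def liftμApp {k j i : D} (a : j ⟶ i) (b : k ⟶ j) (c : k ⟶ i) (h : b ≫ a = c)
    (M : P.Mod k) : tensorMod a (liftObj b M) ⟶ tensorMod c M :=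
  desc a (liftObj b M) (preLiftμ a b c h M) (by
    rw [← cancel_epi ((P.T a).map ((P.T (𝟙 j)).map (π b M))), μ_nat_assoc, π_preLiftμ,
      ← Functor.map_comp_assoc, π_act, Functor.map_comp_assoc, π_preLiftμ,
      μ_assoc_assoc (h₂ := Category.comp_id b) (h₄ := h)])

theorem π_liftμApp {k j i : D} (a : j ⟶ i) (b : k ⟶ j) (c : k ⟶ i) (h : b ≫ a = c)
    (M : P.Mod k) :
    (P.T a).map (π b M) ≫ π a (liftObj b M) ≫ liftμApp a b c h M =
      (P.μ a b c h).app M.A ≫ π c M := by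
  rw [liftμApp, π_desc, π_preLiftμ]

theorem π_liftμApp_assoc {k j i : D} (a : j ⟶ i) (b : k ⟶ j) (c : k ⟶ i) (h : b ≫ a = c)
    (M : P.Mod k) {Z : P.C i} (f : tensorMod c M ⟶ Z) :
    (P.T a).map (π b M) ≫ π a (liftObj b M) ≫ liftμApp a b c h M ≫ f =
      (P.μ a b c h).app M.A ≫ π c M ≫ f := by
  simpa only [Category.assoc, Category.id_comp] using
    eq_whisker (π_liftμApp a b c h M) f

theorem lift_hom_ext₂ {k j i : D} {a : j ⟶ i} {b : k ⟶ j} {M : P.Mod k} {Z : P.C i}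
    {f g : tensorMod a (liftObj b M) ⟶ Z}
    (h : (P.T a).map (π b M) ≫ π a (liftObj b M) ≫ f =
      (P.T a).map (π b M) ≫ π a (liftObj b M) ≫ g) : f = g := by
  rwa [cancel_epi, cancel_epi] at h

/-- The product of the lift, induced by `μ_{a,b}`. -/
noncomputable def liftμ {k j i : D} (a : j ⟶ i) (b : k ⟶ j) (c : k ⟶ i) (h : b ≫ a = c) :
    liftFunctor (P := P) b ⋙ liftFunctor a ⟶ liftFunctor c where
  app M :=
    { f := liftμApp a b c h M
      h := by
        change (P.T (𝟙 i)).map (liftμApp a b c h M) ≫ (liftObj c M).a =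
          (liftObj a (liftObj b M)).a ≫ liftμApp a b c h M
        rw [← cancel_epi ((P.T (𝟙 i)).map (π a (liftObj b M))),
          ← cancel_epi ((P.T (𝟙 i)).map ((P.T a).map (π b M))), π_act_assoc, μ_nat_assoc,
          π_liftμApp, ← Functor.map_comp_assoc, ← Functor.map_comp_assoc, Category.assoc,
          π_liftμApp, Functor.map_comp_assoc, π_act,
          μ_assoc_assoc (h₂ := h) (h₄ := Category.comp_id c)] }
  naturality M N f := by
    apply Monad.Algebra.Hom.ext'
    change (liftMap a (liftMap b f)).f ≫ liftμApp a b c h N =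
      liftμApp a b c h M ≫ (liftMap c f).f
    refine lift_hom_ext₂ ?_
    rw [π_liftμApp_assoc, π_liftMap, π_liftMap_assoc, ← Functor.map_comp_assoc, π_liftMap,
      Functor.map_comp_assoc, π_liftμApp, μ_nat_assoc]

theorem liftμ_app_f {k j i : D} (a : j ⟶ i) (b : k ⟶ j) (c : k ⟶ i) (h : b ≫ a = c)
    (M : P.Mod k) : ((liftμ a b c h).app M).f = liftμApp a b c h M := rfl

variable (P) in
/-- The lift of an r-exact polyad: `i` is sent to the category of `T_i`-modules and
`a : j ⟶ i` to the functor `T_a ⊙_{T_j} ?`; product and unit are induced by `μ` and `η`. -/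
@[reducible]
noncomputable def lift : Polyad.{v, u, v', max u' v'} D where
  C := P.Mod
  cat _ := inferInstance
  T a := liftFunctor a
  μ a b c h := liftμ a b c h
  η i := liftη i
  μ_assoc a b c ab bc abc h₁ h₂ h₃ h₄ M := by
    apply Monad.Algebra.Hom.ext'
    change liftμApp a b ab h₁ (liftObj c M) ≫ liftμApp ab c abc h₃ M =
      (liftMap a ((liftμ b c bc h₂).app M)).f ≫ liftμApp a bc abc h₄ M
    refine lift_hom_ext₂ ?_
    rw [← cancel_epi ((P.T a).map ((P.T b).map (π c M))), π_liftμApp_assoc, μ_nat_assoc,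
      π_liftμApp, π_liftMap_assoc, liftμ_app_f, ← Functor.map_comp_assoc,
      ← Functor.map_comp_assoc, Category.assoc, π_liftμApp, Functor.map_comp_assoc, π_liftμApp,
      μ_assoc_assoc]
  μ_right_unit {j i} a M := by
    apply Monad.Algebra.Hom.ext'
    change (liftMap a ((liftη j).app M)).f ≫ liftμApp a (𝟙 j) a _ M = 𝟙 _
    refine tensorMod_hom_ext ?_
    rw [π_liftMap_assoc, liftη_app_f, Functor.map_comp_assoc, π_liftμApp]
    exact (P.μ_right_unit_assoc a M.A (π a M)).trans (Category.comp_id _).symm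
  μ_left_unit {j i} a M := by
    apply Monad.Algebra.Hom.ext'
    change ((P.η i).app (tensorMod a M) ≫ π (𝟙 i) (liftObj a M)) ≫
      liftμApp (𝟙 i) a a _ M = 𝟙 _
    refine tensorMod_hom_ext ?_
    rw [Category.assoc, η_nat_assoc, π_liftμApp, μ_left_unit_assoc]
    exact (Category.comp_id _).symm

end Polyad

open Functor.OplaxMonoidal in
/-- A comonoidal polyad: the categories `C i` are monoidal, the functors `T a` are comonoidal
(opmonoidal), and the natural transformations `μ_{a,b}` and `η_i` are comonoidal. -/
structure ComonoidalPolyad (D : Type u) [Category.{v} D] extends Polyad.{v, u, v', u'} D where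
  [monoidal : ∀ i, MonoidalCategory (C i)]
  [comonoidal : ∀ {j i : D} (a : j ⟶ i), (T a).OplaxMonoidal]
  μ_tensor : ∀ {k j i : D} (a : j ⟶ i) (b : k ⟶ j) (c : k ⟶ i) (h : b ≫ a = c) (X Y : C k),
    (μ a b c h).app (X ⊗ Y) ≫ δ (T c) X Y =
      (T a).map (δ (T b) X Y) ≫ δ (T a) ((T b).obj X) ((T b).obj Y) ≫
        ((μ a b c h).app X ⊗ₘ (μ a b c h).app Y)
  μ_one : ∀ {k j i : D} (a : j ⟶ i) (b : k ⟶ j) (c : k ⟶ i) (h : b ≫ a = c),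
    (μ a b c h).app (𝟙_ (C k)) ≫ Functor.OplaxMonoidal.η (T c) =
      (T a).map (Functor.OplaxMonoidal.η (T b)) ≫ Functor.OplaxMonoidal.η (T a)
  η_tensor : ∀ (i : D) (X Y : C i),
    (η i).app (X ⊗ Y) ≫ δ (T (𝟙 i)) X Y = ((η i).app X ⊗ₘ (η i).app Y)
  η_one : ∀ i : D, (η i).app (𝟙_ (C i)) ≫ Functor.OplaxMonoidal.η (T (𝟙 i)) = 𝟙 _

namespace ComonoidalPolyad

open Functor.OplaxMonoidal (δ δ_natural_assoc)
open Polyad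

attribute [instance] monoidal comonoidal

variable {D : Type u} [Category.{v} D]

/-- The counit part `T_a 𝟙 ⟶ 𝟙` of the comonoidal structure of `T_a`. -/
abbrev T₀ (P : ComonoidalPolyad.{v, u, v', u'} D) {j i : D} (a : j ⟶ i) :
    (P.T a).obj (𝟙_ (P.C j)) ⟶ 𝟙_ (P.C i) := Functor.OplaxMonoidal.η (P.T a)

/-- The part `T_a (X ⊗ Y) ⟶ T_a X ⊗ T_a Y` of the comonoidal structure of `T_a`. -/
abbrev T₂ (P : ComonoidalPolyad.{v, u, v', u'} D) {j i : D} (a : j ⟶ i) (X Y : P.C j) :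
    (P.T a).obj (X ⊗ Y) ⟶ (P.T a).obj X ⊗ (P.T a).obj Y := Functor.OplaxMonoidal.δ (P.T a) X Y

variable {P : ComonoidalPolyad.{v, u, v', u'} D}

theorem μ_tensor_assoc (P : ComonoidalPolyad.{v, u, v', u'} D) {k j i : D} (a : j ⟶ i)
    (b : k ⟶ j) (c : k ⟶ i) (h : b ≫ a = c) (X Y : P.C k) {Z : P.C i}
    (f : (P.T c).obj X ⊗ (P.T c).obj Y ⟶ Z) :
    (P.μ a b c h).app (X ⊗ Y) ≫ δ (P.T c) X Y ≫ f =
      (P.T a).map (δ (P.T b) X Y) ≫ δ (P.T a) ((P.T b).obj X) ((P.T b).obj Y) ≫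
        ((P.μ a b c h).app X ⊗ₘ (P.μ a b c h).app Y) ≫ f := by
  simpa only [Category.assoc, Category.id_comp] using
    eq_whisker (P.μ_tensor a b c h X Y) f

theorem η_tensor_assoc (P : ComonoidalPolyad.{v, u, v', u'} D) (i : D) (X Y : P.C i) {Z : P.C i}
    (f : (P.T (𝟙 i)).obj X ⊗ (P.T (𝟙 i)).obj Y ⟶ Z) :
    (P.η i).app (X ⊗ Y) ≫ δ (P.T (𝟙 i)) X Y ≫ f = ((P.η i).app X ⊗ₘ (P.η i).app Y) ≫ f := by
  simpa only [Category.assoc, Category.id_comp] using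
    eq_whisker (P.η_tensor i X Y) f

/-- The tensor product of two modules over the comonoidal monad `T_i`. -/
@[reducible]
def modTensor {i : D} (M N : P.Mod i) : P.Mod i where
  A := M.A ⊗ N.A
  a := P.T₂ (𝟙 i) M.A N.A ≫ (M.a ⊗ₘ N.a)
  unit := by
    change (P.η i).app _ ≫ _ = _
    rw [η_tensor_assoc, tensorHom_comp_tensorHom, act_unit, act_unit]
    exact id_tensorHom_id _ _
  assoc := by
    change (P.μ (𝟙 i) (𝟙 i) (𝟙 i) _).app _ ≫ _ = (P.T (𝟙 i)).map _ ≫ _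
    rw [μ_tensor_assoc, Functor.map_comp_assoc, tensorHom_comp_tensorHom, act_assoc, act_assoc,
      ← tensorHom_comp_tensorHom, δ_natural_assoc]

/-- The unit object with its action of the comonoidal monad `T_i`. -/
@[reducible]
def modUnit (i : D) : P.Mod i where
  A := 𝟙_ (P.C i)
  a := P.T₀ (𝟙 i)
  unit := P.η_one i
  assoc := P.μ_one (𝟙 i) (𝟙 i) (𝟙 i) _

/-- The tensor product of two morphisms of `T_i`-modules. -/
@[reducible]
def modTensorHom {i : D} {M M' N N' : P.Mod i} (f : M ⟶ M') (g : N ⟶ N') :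
    modTensor M N ⟶ modTensor M' N' where
  f := f.f ⊗ₘ g.f
  h := by
    change (P.T (𝟙 i)).map (f.f ⊗ₘ g.f) ≫ P.T₂ (𝟙 i) M'.A N'.A ≫ (M'.a ⊗ₘ N'.a) =
      (P.T₂ (𝟙 i) M.A N.A ≫ (M.a ⊗ₘ N.a)) ≫ (f.f ⊗ₘ g.f)
    rw [← δ_natural_assoc, tensorHom_comp_tensorHom, act_hom, act_hom, Category.assoc,
      tensorHom_comp_tensorHom]

/-- The monoidal structure of `T_i`-modules, strictly preserved by the forgetful functor. -/
@[reducible]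
def modMonoidalStruct (i : D) : MonoidalCategoryStruct (P.Mod i) where
  tensorObj := modTensor
  whiskerLeft M _ _ f := modTensorHom (𝟙 M) f
  whiskerRight f N := modTensorHom f (𝟙 N)
  tensorHom := modTensorHom
  tensorUnit := modUnit i
  associator M N L := Monad.Algebra.isoMk (α_ M.A N.A L.A) (by
    change (P.T (𝟙 i)).map (α_ M.A N.A L.A).hom ≫
        P.T₂ (𝟙 i) M.A (N.A ⊗ L.A) ≫ (M.a ⊗ₘ (P.T₂ (𝟙 i) N.A L.A ≫ (N.a ⊗ₘ L.a))) =
      (P.T₂ (𝟙 i) (M.A ⊗ N.A) L.A ≫ ((P.T₂ (𝟙 i) M.A N.A ≫ (M.a ⊗ₘ N.a)) ⊗ₘ L.a)) ≫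
        (α_ M.A N.A L.A).hom
    rw [← whiskerRight_comp_tensorHom, ← whiskerLeft_comp_tensorHom, Category.assoc,
      Category.assoc, associator_naturality, Functor.OplaxMonoidal.associativity_assoc])
  leftUnitor M := Monad.Algebra.isoMk (λ_ M.A) (by
    change (P.T (𝟙 i)).map (λ_ M.A).hom ≫ M.a =
      (P.T₂ (𝟙 i) (𝟙_ _) M.A ≫ (P.T₀ (𝟙 i) ⊗ₘ M.a)) ≫ (λ_ M.A).hom
    rw [MonoidalCategory.tensorHom_def, Category.assoc, Category.assoc, leftUnitor_naturality,
      Functor.OplaxMonoidal.left_unitality_hom_assoc])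
  rightUnitor M := Monad.Algebra.isoMk (ρ_ M.A) (by
    change (P.T (𝟙 i)).map (ρ_ M.A).hom ≫ M.a =
      (P.T₂ (𝟙 i) M.A (𝟙_ _) ≫ (M.a ⊗ₘ P.T₀ (𝟙 i))) ≫ (ρ_ M.A).hom
    rw [MonoidalCategory.tensorHom_def', Category.assoc, Category.assoc, rightUnitor_naturality,
      Functor.OplaxMonoidal.right_unitality_hom_assoc])

/-- The monoidal category of modules over the comonoidal monad `T_i`. -/
@[reducible]
def modMonoidal (i : D) : MonoidalCategory (P.Mod i) :=
  letI : MonoidalCategoryStruct (P.Mod i) := modMonoidalStruct i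
  Monoidal.induced (P.monad i).forget
    { μIso := fun _ _ => Iso.refl _
      εIso := Iso.refl _
      whiskerLeft_eq := fun M _ _ f => by
        change 𝟙 M.A ⊗ₘ f.f = 𝟙 _ ≫ M.A ◁ f.f ≫ 𝟙 _
        simp
      whiskerRight_eq := fun f N => by
        change f.f ⊗ₘ 𝟙 N.A = 𝟙 _ ≫ f.f ▷ N.A ≫ 𝟙 _
        simp
      tensorHom_eq := fun f g => by
        change f.f ⊗ₘ g.f = 𝟙 _ ≫ (f.f ⊗ₘ g.f) ≫ 𝟙 _
        simp
      associator_eq := fun M N L => by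
        change (α_ M.A N.A L.A).hom = (𝟙 _ ≫ (𝟙 _ ⊗ₘ 𝟙 _)) ≫ (α_ M.A N.A L.A).hom ≫
          (𝟙 _ ⊗ₘ 𝟙 _) ≫ 𝟙 _
        simp
      leftUnitor_eq := fun M => by
        change (λ_ M.A).hom = (𝟙 _ ≫ (𝟙 _ ⊗ₘ 𝟙 _)) ≫ (λ_ M.A).hom
        simp
      rightUnitor_eq := fun M => by
        change (ρ_ M.A).hom = (𝟙 _ ≫ (𝟙 _ ⊗ₘ 𝟙 _)) ≫ (ρ_ M.A).hom
        simp }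

attribute [instance] modMonoidal

variable [P.toPolyad.IsRExact]

/-- The morphism `T_a ⊙ (M ⊗ N) ⟶ (T_a ⊙ M) ⊗ (T_a ⊙ N)` induced by the comonoidal structure
of `T_a`. -/
noncomputable def lift₂ {j i : D} (a : j ⟶ i) (M N : P.Mod j) :
    tensorMod a (modTensor M N) ⟶ tensorMod a M ⊗ tensorMod a N :=
  desc a (modTensor M N) (P.T₂ a M.A N.A ≫ (π a M ⊗ₘ π a N)) (by
    rw [μ_tensor_assoc, tensorHom_comp_tensorHom, π_condition, π_condition,
      Functor.map_comp_assoc, ← δ_natural_assoc, tensorHom_comp_tensorHom])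

theorem π_lift₂ {j i : D} (a : j ⟶ i) (M N : P.Mod j) :
    π a (modTensor M N) ≫ lift₂ a M N = P.T₂ a M.A N.A ≫ (π a M ⊗ₘ π a N) :=
  π_desc ..

theorem π_lift₂_assoc {j i : D} (a : j ⟶ i) (M N : P.Mod j) {Z : P.C i}
    (f : tensorMod a M ⊗ tensorMod a N ⟶ Z) :
    π a (modTensor M N) ≫ lift₂ a M N ≫ f = P.T₂ a M.A N.A ≫ (π a M ⊗ₘ π a N) ≫ f := by
  simpa only [Category.assoc, Category.id_comp] using
    eq_whisker (π_lift₂ a M N) f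

/-- The morphism `T_a ⊙ 𝟙 ⟶ 𝟙` induced by the comonoidal structure of `T_a`. -/
noncomputable def lift₀ {j i : D} (a : j ⟶ i) :
    tensorMod a (modUnit (P := P) j) ⟶ 𝟙_ (P.C i) :=
  desc a (modUnit j) (P.T₀ a) (P.μ_one a (𝟙 j) a _)

theorem π_lift₀ {j i : D} (a : j ⟶ i) : π a (modUnit (P := P) j) ≫ lift₀ a = P.T₀ a :=
  π_desc ..

/-- `lift₂` as a morphism of `T_i`-modules. -/
noncomputable def lift₂Hom {j i : D} (a : j ⟶ i) (M N : P.Mod j) :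
    liftObj a (M ⊗ N) ⟶ liftObj a M ⊗ liftObj a N where
  f := lift₂ a M N
  h := by
    change (P.T (𝟙 i)).map (lift₂ a M N) ≫ P.T₂ (𝟙 i) (tensorMod a M) (tensorMod a N) ≫
      ((liftObj a M).a ⊗ₘ (liftObj a N).a) = (liftObj a (modTensor M N)).a ≫ lift₂ a M N
    rw [← cancel_epi ((P.T (𝟙 i)).map (π a (modTensor M N))), π_act_assoc, π_lift₂,
      ← Functor.map_comp_assoc, π_lift₂, Functor.map_comp_assoc, ← δ_natural_assoc,
      tensorHom_comp_tensorHom, π_act, π_act, μ_tensor_assoc, tensorHom_comp_tensorHom]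

/-- `lift₀` as a morphism of `T_i`-modules. -/
noncomputable def lift₀Hom {j i : D} (a : j ⟶ i) :
    liftObj a (𝟙_ (P.Mod j)) ⟶ 𝟙_ (P.Mod i) where
  f := lift₀ a
  h := by
    change (P.T (𝟙 i)).map (lift₀ a) ≫ P.T₀ (𝟙 i) = (liftObj a (modUnit j)).a ≫ lift₀ a
    rw [← cancel_epi ((P.T (𝟙 i)).map (π a (modUnit j))), π_act_assoc, π_lift₀,
      ← Functor.map_comp_assoc, π_lift₀, μ_one]

theorem lift₂_natural {j i : D} (a : j ⟶ i) {M M' N N' : P.Mod j} (f : M ⟶ M') (g : N ⟶ N') :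
    lift₂ a M N ≫ ((liftMap a f).f ⊗ₘ (liftMap a g).f) =
      (liftMap a (modTensorHom f g)).f ≫ lift₂ a M' N' := by
  refine tensorMod_hom_ext ?_
  rw [π_lift₂_assoc, π_liftMap_assoc, π_lift₂, tensorHom_comp_tensorHom, π_liftMap, π_liftMap,
    ← tensorHom_comp_tensorHom, δ_natural_assoc]

/-- The comonoidal structure of the functor `T_a ⊙_{T_j} ?`. -/
@[reducible]
noncomputable def liftComonoidal {j i : D} (a : j ⟶ i) :
    (liftFunctor (P := P.toPolyad) a).OplaxMonoidal where
  η := lift₀Hom a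
  δ := lift₂Hom a
  δ_natural_left {M M'} f N := by
    apply Monad.Algebra.Hom.ext'
    have h := lift₂_natural a f (𝟙 N)
    rw [show liftMap a (𝟙 N) = 𝟙 _ from (liftFunctor a).map_id N] at h
    exact h
  δ_natural_right {N N'} M f := by
    apply Monad.Algebra.Hom.ext'
    have h := lift₂_natural a (𝟙 M) f
    rw [show liftMap a (𝟙 M) = 𝟙 _ from (liftFunctor a).map_id M] at h
    exact h
  oplax_associativity M N L := by
    apply Monad.Algebra.Hom.ext'
    change lift₂ a (modTensor M N) L ≫ (lift₂ a M N ⊗ₘ 𝟙 (tensorMod a L)) ≫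
        (α_ (tensorMod a M) (tensorMod a N) (tensorMod a L)).hom =
      (liftMap (M := modTensor (modTensor M N) L) (N := modTensor M (modTensor N L)) a
        (α_ M N L).hom).f ≫ lift₂ a M (modTensor N L) ≫
        (𝟙 (tensorMod a M) ⊗ₘ lift₂ a N L)
    refine tensorMod_hom_ext ?_
    rw [π_lift₂_assoc, π_liftMap_assoc, π_lift₂_assoc, tensorHom_comp_tensorHom_assoc,
      tensorHom_comp_tensorHom, π_lift₂, π_lift₂, Category.comp_id, Category.comp_id,
      ← whiskerRight_comp_tensorHom, ← whiskerLeft_comp_tensorHom, Category.assoc,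
      associator_naturality, Functor.OplaxMonoidal.associativity_assoc]
    rfl
  oplax_left_unitality M := by
    apply Monad.Algebra.Hom.ext'
    change (λ_ (tensorMod a M)).inv =
      (liftMap (N := modTensor (modUnit j) M) a (λ_ M).inv).f ≫ lift₂ a (modUnit j) M ≫
      (lift₀ a ⊗ₘ 𝟙 (tensorMod a M))
    refine tensorMod_hom_ext ?_
    rw [π_liftMap_assoc, π_lift₂_assoc, tensorHom_comp_tensorHom, π_lift₀, Category.comp_id,
      MonoidalCategory.tensorHom_def, leftUnitor_inv_naturality,
      Functor.OplaxMonoidal.left_unitality]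
    simp only [Category.assoc]
    rfl
  oplax_right_unitality M := by
    apply Monad.Algebra.Hom.ext'
    change (ρ_ (tensorMod a M)).inv =
      (liftMap (N := modTensor M (modUnit j)) a (ρ_ M).inv).f ≫ lift₂ a M (modUnit j) ≫
      (𝟙 (tensorMod a M) ⊗ₘ lift₀ a)
    refine tensorMod_hom_ext ?_
    rw [π_liftMap_assoc, π_lift₂_assoc, tensorHom_comp_tensorHom, π_lift₀, Category.comp_id,
      MonoidalCategory.tensorHom_def', rightUnitor_inv_naturality,
      Functor.OplaxMonoidal.right_unitality]
    simp only [Category.assoc]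
    rfl

variable (P) in
/-- The lift of a comonoidal polyad whose underlying polyad is r-exact, as a comonoidal polyad. -/
@[reducible]
noncomputable def lift : ComonoidalPolyad.{v, u, v', max u' v'} D where
  toPolyad := P.toPolyad.lift
  monoidal i := modMonoidal (P := P) i
  comonoidal a := liftComonoidal (P := P) a
  μ_tensor a b c h M N := by
    apply Monad.Algebra.Hom.ext'
    change liftμApp a b c h (modTensor M N) ≫ lift₂ c M N =
      (liftMap (M := liftObj b (modTensor M N)) (N := modTensor (liftObj b M) (liftObj b N)) a
        (lift₂Hom b M N)).f ≫ lift₂ a (liftObj b M) (liftObj b N) ≫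
        (liftμApp a b c h M ⊗ₘ liftμApp a b c h N)
    refine lift_hom_ext₂ ?_
    rw [π_liftμApp_assoc, π_lift₂, π_liftMap_assoc, π_lift₂_assoc, tensorHom_comp_tensorHom,
      μ_tensor_assoc, tensorHom_comp_tensorHom, ← π_liftμApp, ← π_liftμApp,
      ← tensorHom_comp_tensorHom, δ_natural_assoc, ← Functor.map_comp_assoc,
      ← Functor.map_comp_assoc]
    congr 2
    exact (π_lift₂ b M N).symm
  μ_one a b c h := by
    apply Monad.Algebra.Hom.ext'
    change liftμApp a b c h (modUnit _) ≫ lift₀ c = (liftMap a (lift₀Hom b)).f ≫ lift₀ a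
    refine lift_hom_ext₂ ?_
    rw [π_liftμApp_assoc, π_lift₀, π_liftMap_assoc, μ_one, ← Functor.map_comp_assoc]
    congr 1
    · exact congrArg _ (π_lift₀ b).symm
    · exact (π_lift₀ a).symm
  η_tensor i M N := by
    apply Monad.Algebra.Hom.ext'
    change ((P.η i).app (M.A ⊗ N.A) ≫ π (𝟙 i) (modTensor M N)) ≫ lift₂ (𝟙 i) M N =
      (((P.η i).app M.A ≫ π (𝟙 i) M) ⊗ₘ ((P.η i).app N.A ≫ π (𝟙 i) N))
    rw [Category.assoc, π_lift₂, η_tensor_assoc, tensorHom_comp_tensorHom]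
  η_one i := by
    apply Monad.Algebra.Hom.ext'
    change ((P.η i).app (𝟙_ (P.C i)) ≫ π (𝟙 i) (modUnit i)) ≫ lift₀ (𝟙 i) = 𝟙 _
    rw [Category.assoc, π_lift₀, η_one]

/-- An r-exact comonoidal polyad: it is r-exact as a polyad, and the tensor product of each `C i`
preserves coequalizers of reflexive pairs in each variable. -/
class IsRExact (P : ComonoidalPolyad.{v, u, v', u'} D) : Prop extends P.toPolyad.IsRExact where
  tensorLeft_preserves : ∀ (i : D) (X : P.C i),
    Monad.PreservesColimitOfIsReflexivePair (tensorLeft X)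
  tensorRight_preserves : ∀ (i : D) (X : P.C i),
    Monad.PreservesColimitOfIsReflexivePair (tensorRight X)

/-- The left fusion operator `H^l_{a,b}(X, Y) : T_a (X ⊗ T_b Y) ⟶ T_a X ⊗ T_{ab} Y`. -/
def leftFusion (P : ComonoidalPolyad.{v, u, v', u'} D) {k j i : D} (a : j ⟶ i) (b : k ⟶ j)
    (X : P.C j) (Y : P.C k) :
    (P.T a).obj (X ⊗ (P.T b).obj Y) ⟶ (P.T a).obj X ⊗ (P.T (b ≫ a)).obj Y :=
  P.T₂ a X ((P.T b).obj Y) ≫ (P.T a).obj X ◁ (P.μ a b (b ≫ a) rfl).app Y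

/-- The right fusion operator `H^r_{a,b}(Y, X) : T_a (T_b Y ⊗ X) ⟶ T_{ab} Y ⊗ T_a X`. -/
def rightFusion (P : ComonoidalPolyad.{v, u, v', u'} D) {k j i : D} (a : j ⟶ i) (b : k ⟶ j)
    (Y : P.C k) (X : P.C j) :
    (P.T a).obj ((P.T b).obj Y ⊗ X) ⟶ (P.T (b ≫ a)).obj Y ⊗ (P.T a).obj X :=
  P.T₂ a ((P.T b).obj Y) X ≫ (P.μ a b (b ≫ a) rfl).app Y ▷ (P.T a).obj X

/-- A left Hopf polyad: the left fusion operator is an isomorphism. -/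
def IsLeftHopf (P : ComonoidalPolyad.{v, u, v', u'} D) : Prop :=
  ∀ ⦃k j i : D⦄ (a : j ⟶ i) (b : k ⟶ j) (X : P.C j) (Y : P.C k), IsIso (P.leftFusion a b X Y)

/-- A right Hopf polyad: the right fusion operator is an isomorphism. -/
def IsRightHopf (P : ComonoidalPolyad.{v, u, v', u'} D) : Prop :=
  ∀ ⦃k j i : D⦄ (a : j ⟶ i) (b : k ⟶ j) (Y : P.C k) (X : P.C j), IsIso (P.rightFusion a b Y X)

/-- A Hopf polyad: both fusion operators are isomorphisms. -/
def IsHopf (P : ComonoidalPolyad.{v, u, v', u'} D) : Prop :=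
  P.IsLeftHopf ∧ P.IsRightHopf

end ComonoidalPolyad

namespace CategoryTheory.Monad

/-! ### Reflexive coequalizers in categories of modules over a monad. -/

section Reflexive

universe w w₁ w₂ w₃

variable {C : Type w₁} [Category.{w} C] {E : Type w₂} [Category.{w} E]
  {E' : Type w₃} [Category.{w} E']

/-! Each monad `T_i` preserves reflexive coequalizers, so the forgetful functor from `T_i`-modules
creates them. This gives r-exactness of the lift: `T_a ⊙ ?` is itself a coequalizer of functors that
preserve reflexive coequalizers, and the tensor product of modules is computed on underlying
objects.

Source and target of a lifted fusion operator then preserve reflexive coequalizers in each variable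
separately. Every module is a reflexive coequalizer of free ones (Beck), so invertibility need only
be tested on free modules (`isIso_app_of_isIso_app_free`).

For free modules, `T_b ⊙ T_k Y` is `T_b Y` (`isIso_toTensorFree`). The fusion operator
`H^l_{id,b}(X, Y)` identifies the free module `T_j (X ⊗ T_b Y)` with `T_j X ⊗ T_b Y`; hence `T_a ⊙
(T_j X ⊗ T_b Y)` is `T_a (X ⊗ T_b Y)` (`isIso_map_comp_π`). Under these identifications the lifted
operator becomes `H^l_{a,b}(X, Y)`, which is invertible by hypothesis
(`isIso_leftFusion_lift_free`). The Hopf condition is thus used twice, for `(id, b)` and for `(a,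
b)`. The right-handed case is the mirror image. -/

theorem preservesColimit_parallelPair_comp (F : C ⥤ E) (G : E ⥤ E') {X Y : C} (f g : X ⟶ Y)
    [h : PreservesColimit (parallelPair (F.map f) (F.map g)) G] :
    PreservesColimit (parallelPair f g ⋙ F) G :=
  haveI : PreservesColimit (parallelPair ((parallelPair f g ⋙ F).map .left)
    ((parallelPair f g ⋙ F).map .right)) G := h
  preservesColimit_of_iso_diagram G (diagramIsoParallelPair (parallelPair f g ⋙ F)).symm

instance PreservesColimitOfIsReflexivePair.comp (F : C ⥤ E) (G : E ⥤ E')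
    [PreservesColimitOfIsReflexivePair F] [PreservesColimitOfIsReflexivePair G] :
    PreservesColimitOfIsReflexivePair (F ⋙ G) where
  out _ _ f g _ :=
    haveI := Polyad.isReflexivePair_map F f g
    haveI := preservesColimit_parallelPair_comp F G f g
    comp_preservesColimit F G

theorem hasColimit_parallelPair_comp_forget [HasReflexiveCoequalizers C] {T : Monad C}
    {M N : T.Algebra} (f g : M ⟶ N)
    [IsReflexivePair f g] : HasColimit (parallelPair f g ⋙ T.forget) :=
  haveI := Polyad.isReflexivePair_map T.forget f g
  haveI : HasColimit (parallelPair ((parallelPair f g ⋙ T.forget).map .left)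
    ((parallelPair f g ⋙ T.forget).map .right)) :=
    inferInstanceAs (HasCoequalizer (T.forget.map f) (T.forget.map g))
  hasColimit_of_iso (diagramIsoParallelPair (parallelPair f g ⋙ T.forget))

variable {T : Monad C} [PreservesColimitOfIsReflexivePair (T : C ⥤ C)]

/-- The forgetful functor of a monad which preserves reflexive coequalizers creates them. -/
noncomputable instance createsColimitOfIsReflexivePair {M N : T.Algebra} (f g : M ⟶ N)
    [IsReflexivePair f g] : CreatesColimit (parallelPair f g) T.forget :=
  -- Creation requires the monad to preserve the underlying coequalizer, to define the action, and
  -- also the image of that coequalizer under the monad, to prove associativity. Both pairs are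
  -- reflexive because functors carry common sections to common sections.
  haveI := Polyad.isReflexivePair_map T.forget f g
  haveI := Polyad.isReflexivePair_map (T.forget ⋙ (T : C ⥤ C)) f g
  haveI := preservesColimit_parallelPair_comp T.forget (T : C ⥤ C) f g
  haveI : PreservesColimit ((parallelPair f g ⋙ T.forget) ⋙ (T : C ⥤ C)) (T : C ⥤ C) :=
    preservesColimit_parallelPair_comp (T.forget ⋙ (T : C ⥤ C)) (T : C ⥤ C) f g
  inferInstance

/-- Created colimits are reflected, so preservation can be tested on underlying objects. -/
theorem preservesColimitOfIsReflexivePair_of_comp_forget (F : E ⥤ T.Algebra)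
    [PreservesColimitOfIsReflexivePair (F ⋙ T.forget)] : PreservesColimitOfIsReflexivePair F where
  out _ _ f g _ :=
    haveI := Polyad.isReflexivePair_map F f g
    haveI : ReflectsColimit (parallelPair ((parallelPair f g ⋙ F).map .left)
      ((parallelPair f g ⋙ F).map .right)) T.forget :=
      inferInstanceAs (ReflectsColimit (parallelPair (F.map f) (F.map g)) T.forget)
    haveI : ReflectsColimit (parallelPair f g ⋙ F) T.forget :=
      reflectsColimit_of_iso_diagram _ (diagramIsoParallelPair (parallelPair f g ⋙ F)).symm
    preservesColimit_of_reflects_of_preserves F T.forget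

variable [HasReflexiveCoequalizers C]

theorem hasReflexiveCoequalizers_algebra : HasReflexiveCoequalizers T.Algebra where
  has_coeq _ _ f g _ :=
    haveI := hasColimit_parallelPair_comp_forget f g
    hasColimit_of_created (parallelPair f g) T.forget

instance preservesColimitOfIsReflexivePair_forget :
    PreservesColimitOfIsReflexivePair T.forget where
  out _ _ f g _ :=
    haveI := hasColimit_parallelPair_comp_forget f g
    inferInstance

end Reflexive

/-! ### Reduction to free modules. -/

section Beck

universe w w₁ w₂

variable {C : Type w₁} [Category.{w} C] {E : Type w₂} [Category.{w} E]

/-- A natural transformation between functors preserving reflexive coequalizers is invertible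
as soon as it is invertible on free modules. -/
theorem isIso_app_of_isIso_app_free {T : Monad C} {F G : T.Algebra ⥤ E}
    [PreservesColimitOfIsReflexivePair F] [PreservesColimitOfIsReflexivePair G] (α : F ⟶ G)
    (h : ∀ X, IsIso (α.app (T.free.obj X))) (M : T.Algebra) : IsIso (α.app M) := by
  let p : T.free.obj M.A ⟶ M := (beckAlgebraCofork M).π
  have w : FreeCoequalizer.topMap M ≫ p = FreeCoequalizer.bottomMap M ≫ p :=
    (beckAlgebraCofork M).condition
  -- The Beck pair is reflexive, so `F` and `G` both preserve its coequalizer.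
  let hF := isColimitCoforkMapOfIsColimit F w (beckAlgebraCoequalizer M)
  let hG := isColimitCoforkMapOfIsColimit G w (beckAlgebraCoequalizer M)
  have : IsIso (α.app (T.free.obj M.A)) := h _
  have : IsIso (α.app (T.free.obj (T.obj M.A))) := h _
  -- The inverse of `α` on the free modules of the presentation induces the inverse `k` of `α` on
  -- their coequalizer.
  have hw : G.map (FreeCoequalizer.topMap M) ≫ inv (α.app (T.free.obj M.A)) ≫ F.map p =
      G.map (FreeCoequalizer.bottomMap M) ≫ inv (α.app (T.free.obj M.A)) ≫ F.map p := by
    rw [← cancel_epi (α.app _), ← α.naturality_assoc, ← α.naturality_assoc,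
      IsIso.hom_inv_id_assoc, ← F.map_comp, ← F.map_comp, w]
  obtain ⟨k, hk⟩ := Cofork.IsColimit.desc' hG _ hw
  change G.map p ≫ k = _ at hk
  refine ⟨k, ?_, ?_⟩
  · refine Cofork.IsColimit.hom_ext hF ?_
    change F.map p ≫ _ = F.map p ≫ _
    rw [α.naturality_assoc, hk, IsIso.hom_inv_id_assoc]
    exact (Category.comp_id _).symm
  · refine Cofork.IsColimit.hom_ext hG ?_
    change G.map p ≫ _ = G.map p ≫ _
    rw [reassoc_of% hk, α.naturality, IsIso.inv_hom_id_assoc]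
    exact (Category.comp_id _).symm

end Beck

end CategoryTheory.Monad

/-! ### Exactness of the functors `T_a ⊙ ?`, and their values on free modules. -/

namespace Polyad

open Monad

variable {D : Type u} [Category.{v} D] {P : Polyad.{v, u, v', u'} D} [P.IsRExact]

instance (i : D) : PreservesColimitOfIsReflexivePair (P.monad i : P.C i ⥤ P.C i) :=
  inferInstanceAs (PreservesColimitOfIsReflexivePair (P.T (𝟙 i)))

/-- The functors `T_a ⊙_{T_j} ?` preserve reflexive coequalizers, since colimits commute with
colimits. -/
theorem preservesColimitOfIsReflexivePair_liftFunctor_forget {j i : D} (a : j ⟶ i) :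
    PreservesColimitOfIsReflexivePair
      (liftFunctor (P := P) a ⋙ (P.monad i).forget) where
  out M N f g _ := by
    have : HasReflexiveCoequalizers (P.Mod j) := hasReflexiveCoequalizers_algebra
    let q := coequalizer.π f g
    -- Before passing to the quotient `T_a ⊙ ?`, the functor `T_a` already sends `q` to a
    -- coequalizer. A cofork on the quotients, pulled back along `π`, therefore factors through `T_a
    -- q` as `k`.
    have hc := isColimitOfHasCoequalizerOfPreservesColimit ((P.monad j).forget ⋙ P.T a) f g
    have : Epi ((P.T a).map ((P.T (𝟙 j)).map q.f)) :=
      epi_of_isColimit_cofork (isColimitOfHasCoequalizerOfPreservesColimit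
        (((P.monad j).forget ⋙ P.T (𝟙 j)) ⋙ P.T a) f g)
    have : Epi ((P.T a).map q.f) := epi_of_isColimit_cofork hc
    refine preservesColimit_of_preserves_colimit_cocone (coequalizerIsCoequalizer f g)
      ((isColimitMapCoconeCoforkEquiv _ _).symm (Cofork.IsColimit.mk' _ fun s => ?_))
    let r : tensorMod a N ⟶ s.pt := s.π
    have hs : (liftMap a f).f ≫ r = (liftMap a g).f ≫ r := s.condition
    have e : (P.T a).map f.f ≫ π a N ≫ r = (P.T a).map g.f ≫ π a N ≫ r := by
      rw [← π_liftMap_assoc, ← π_liftMap_assoc, hs]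
    let k : (P.T a).obj (coequalizer f g).A ⟶ s.pt := Cofork.IsColimit.desc hc (π a N ≫ r) e
    have hk : (P.T a).map q.f ≫ k = π a N ≫ r := Cofork.IsColimit.π_desc' hc _ e
    -- That `k` is compatible with the two actions of `T_j` is checked after the epimorphism `T_a
    -- T_j q`, where it follows from the same fact for `N`.
    have hk' : π a N ≫ (liftMap a q).f ≫ desc a (coequalizer f g) k (by
        rw [← cancel_epi ((P.T a).map ((P.T (𝟙 j)).map q.f)), μ_nat_assoc, hk,
          ← Functor.map_comp_assoc, act_hom, Functor.map_comp_assoc, hk, ← Category.assoc,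
          π_condition, Category.assoc]) = π a N ≫ r := by
      rw [π_liftMap_assoc, π_desc, hk]
    refine ⟨desc a (coequalizer f g) k _, tensorMod_hom_ext hk', fun {m} hm => ?_⟩
    refine tensorMod_hom_ext (M := coequalizer f g) ?_
    rw [← cancel_epi ((P.T a).map q.f), π_desc, hk]
    refine (π_liftMap_assoc a q _).symm.trans ?_
    exact congrArg (π a N ≫ ·) hm

instance preservesColimitOfIsReflexivePair_liftFunctor {j i : D} (a : j ⟶ i) :
    PreservesColimitOfIsReflexivePair (liftFunctor (P := P) a) :=
  haveI := preservesColimitOfIsReflexivePair_liftFunctor_forget (P := P) a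
  preservesColimitOfIsReflexivePair_of_comp_forget (T := P.monad i) (liftFunctor (P := P) a)

theorem isRExact_lift : P.lift.IsRExact where
  hasReflexiveCoequalizers i := hasReflexiveCoequalizers_algebra (T := P.monad i)
  preserves a := preservesColimitOfIsReflexivePair_liftFunctor (P := P) a

/-- The free `T_i`-module on an object of `C i`. -/
@[reducible]
def freeMod (i : D) (X : P.C i) : P.Mod i where
  A := (P.T (𝟙 i)).obj X
  a := (P.μ (𝟙 i) (𝟙 i) (𝟙 i) (Category.comp_id _)).app X
  unit := P.μ_left_unit (𝟙 i) X
  assoc := P.μ_assoc _ _ _ _ _ _ _ _ _ _ X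

/-- The canonical morphism `T_a X ⟶ T_a ⊙_{T_j} T_j X`. -/
noncomputable def toTensorFree {j i : D} (a : j ⟶ i) (X : P.C j) :
    (P.T a).obj X ⟶ tensorMod a (freeMod j X) :=
  (P.T a).map ((P.η j).app X) ≫ π a (freeMod j X)

/-- The inverse is induced by `μ_{a,id}`, which coequalizes the defining pair by associativity; the
unit axioms make the two maps mutually inverse. -/
instance isIso_toTensorFree {j i : D} (a : j ⟶ i) (X : P.C j) : IsIso (toTensorFree a X) := by
  refine ⟨desc a (freeMod j X) ((P.μ a (𝟙 j) a (Category.id_comp a)).app X)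
    (P.μ_assoc a (𝟙 j) (𝟙 j) a (𝟙 j) a _ _ _ _ X), ?_, tensorMod_hom_ext ?_⟩
  · rw [toTensorFree, Category.assoc, π_desc]
    exact P.μ_right_unit a X
  · have h : (P.T a).map ((P.T (𝟙 j)).map ((P.η j).app X)) ≫ (P.T a).map (freeMod j X).a =
        𝟙 _ := by
      rw [← Functor.map_comp, P.μ_right_unit]
      exact (P.T a).map_id _
    rw [reassoc_of% π_desc, toTensorFree, ← μ_nat_assoc, Category.comp_id,
      π_condition a (freeMod j X), reassoc_of% h]

/-- On free modules the lifted product is the original `μ`, once `T_b ⊙ T_k Y` is identified with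
`T_b Y`. -/
theorem μ_toTensorFree {k j i : D} (a : j ⟶ i) (b : k ⟶ j) (c : k ⟶ i) (h : b ≫ a = c)
    (Y : P.C k) :
    (P.T a).map (toTensorFree b Y) ≫ π a (liftObj b (freeMod k Y)) ≫
        liftμApp a b c h (freeMod k Y) =
      (P.μ a b c h).app Y ≫ toTensorFree c Y := by
  rw [toTensorFree, Functor.map_comp_assoc, π_liftμApp, toTensorFree, ← μ_nat_assoc]

/-- Under the same identification the module `T_a ⊙ T_j X` is `T_a X` with action `μ_{id,a}`. -/
theorem toTensorFree_act {j i : D} (a : j ⟶ i) (X : P.C j) :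
    (P.T (𝟙 i)).map (toTensorFree a X) ≫ (liftObj a (freeMod j X)).a =
      (P.μ (𝟙 i) a a (Category.comp_id a)).app X ≫ toTensorFree a X := by
  rw [toTensorFree, Functor.map_comp_assoc, π_act, ← μ_nat_assoc]

/-- If the module morphism `T_j Z ⟶ M` which extends `g : Z ⟶ M` is invertible, then so is the
composite `T_a Z ⟶ T_a M ⟶ T_a ⊙_{T_j} M`. -/
theorem isIso_map_comp_π {j i : D} (a : j ⟶ i) {Z : P.C j} {M : P.Mod j} (g : Z ⟶ M.A)
    [IsIso ((P.T (𝟙 j)).map g ≫ M.a)] : IsIso ((P.T a).map g ≫ π a M) := by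
  let e : freeMod j Z ⟶ M :=
    { f := (P.T (𝟙 j)).map g ≫ M.a
      h := by
        change (P.T (𝟙 j)).map _ ≫ M.a = (P.μ (𝟙 j) (𝟙 j) (𝟙 j) _).app Z ≫ _
        rw [Functor.map_comp_assoc, ← act_assoc, μ_nat_assoc] }
  have : IsIso e.f := ‹_›
  have : IsIso e := Monad.algebra_iso_of_iso (P.monad j) e
  have : IsIso ((liftFunctor (P := P) a).map e) := (liftFunctor a).map_isIso e
  have : IsIso (liftMap a e).f :=
    (P.monad i).forget.map_isIso ((liftFunctor a).map e)
  -- The composite is the canonical isomorphism for the free module on `Z`, followed by `T_a ⊙ e`.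
  have h : (P.T a).map g ≫ π a M = toTensorFree a Z ≫ (liftMap a e).f := by
    rw [toTensorFree, Category.assoc, π_liftMap, ← Functor.map_comp_assoc, ← η_nat_assoc,
      act_unit, Category.comp_id]
  rw [h]
  infer_instance

end Polyad

namespace ComonoidalPolyad

open Functor.OplaxMonoidal (δ δ_natural_assoc δ_natural)
open Polyad Monad

variable {D : Type u} [Category.{v} D]

/-! ### Exactness of the tensor product of modules. -/

/-- The forgetful functor is strictly monoidal, so it carries tensoring with `M` to tensoring with
`M.A`; the comparison `e` has identity components. -/
theorem preservesColimitOfIsReflexivePair_tensorLeft {P : ComonoidalPolyad.{v, u, v', u'} D}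
    [P.IsRExact] {i : D} (M : P.Mod i) : PreservesColimitOfIsReflexivePair (tensorLeft M) :=
  haveI := IsRExact.tensorLeft_preserves (P := P) i M.A
  let e : (P.monad i).forget ⋙ tensorLeft M.A ≅ tensorLeft M ⋙ (P.monad i).forget :=
    NatIso.ofComponents (fun _ => Iso.refl _) fun {N N'} f => by
      change M.A ◁ f.f ≫ 𝟙 _ = 𝟙 _ ≫ (𝟙 M.A ⊗ₘ f.f)
      simp
  haveI : PreservesColimitOfIsReflexivePair (tensorLeft M ⋙ (P.monad i).forget) :=
    ⟨fun _ _ _ _ => preservesColimit_of_natIso _ e⟩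
  preservesColimitOfIsReflexivePair_of_comp_forget (tensorLeft M)

theorem preservesColimitOfIsReflexivePair_tensorRight {P : ComonoidalPolyad.{v, u, v', u'} D}
    [P.IsRExact] {i : D} (M : P.Mod i) : PreservesColimitOfIsReflexivePair (tensorRight M) :=
  haveI := IsRExact.tensorRight_preserves (P := P) i M.A
  let e : (P.monad i).forget ⋙ tensorRight M.A ≅ tensorRight M ⋙ (P.monad i).forget :=
    NatIso.ofComponents (fun _ => Iso.refl _) fun {N N'} f => by
      change f.f ▷ M.A ≫ 𝟙 _ = 𝟙 _ ≫ (f.f ⊗ₘ 𝟙 M.A)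
      simp
  haveI : PreservesColimitOfIsReflexivePair (tensorRight M ⋙ (P.monad i).forget) :=
    ⟨fun _ _ _ _ => preservesColimit_of_natIso _ e⟩
  preservesColimitOfIsReflexivePair_of_comp_forget (tensorRight M)

theorem isRExact_lift (P : ComonoidalPolyad.{v, u, v', u'} D) [P.IsRExact] : P.lift.IsRExact where
  toIsRExact := Polyad.isRExact_lift
  tensorLeft_preserves _ M := preservesColimitOfIsReflexivePair_tensorLeft (P := P) M
  tensorRight_preserves _ M := preservesColimitOfIsReflexivePair_tensorRight (P := P) M

/-! ### Naturality of the fusion operators in each variable. -/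

section Fusion

variable (Q : ComonoidalPolyad.{v, u, v', u'} D) {k j i : D} (a : j ⟶ i) (b : k ⟶ j)

/-- The left fusion operator as a transformation natural in its first variable. -/
def leftFusionNatFst (Y : Q.C k) :
    tensorRight ((Q.T b).obj Y) ⋙ Q.T a ⟶ Q.T a ⋙ tensorRight ((Q.T (b ≫ a)).obj Y) where
  app X := Q.leftFusion a b X Y
  naturality X X' f := by
    change (Q.T a).map (f ▷ _) ≫ δ _ _ _ ≫ _ = (δ _ _ _ ≫ _) ≫ (Q.T a).map f ▷ _
    rw [← Functor.OplaxMonoidal.δ_natural_left_assoc, Category.assoc, whisker_exchange]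

/-- The left fusion operator as a transformation natural in its second variable. -/
def leftFusionNatSnd (X : Q.C j) :
    Q.T b ⋙ tensorLeft X ⋙ Q.T a ⟶ Q.T (b ≫ a) ⋙ tensorLeft ((Q.T a).obj X) where
  app Y := Q.leftFusion a b X Y
  naturality Y Y' f := by
    change (Q.T a).map (_ ◁ (Q.T b).map f) ≫ δ _ _ _ ≫ _ =
      (δ _ _ _ ≫ _) ≫ _ ◁ (Q.T (b ≫ a)).map f
    rw [← Functor.OplaxMonoidal.δ_natural_right_assoc, Category.assoc,
      ← MonoidalCategory.whiskerLeft_comp, ← MonoidalCategory.whiskerLeft_comp, μ_nat]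

/-- The right fusion operator as a transformation natural in its second variable. -/
def rightFusionNatSnd (Y : Q.C k) :
    tensorLeft ((Q.T b).obj Y) ⋙ Q.T a ⟶ Q.T a ⋙ tensorLeft ((Q.T (b ≫ a)).obj Y) where
  app X := Q.rightFusion a b Y X
  naturality X X' f := by
    change (Q.T a).map (_ ◁ f) ≫ δ _ _ _ ≫ _ = (δ _ _ _ ≫ _) ≫ _ ◁ (Q.T a).map f
    rw [← Functor.OplaxMonoidal.δ_natural_right_assoc, Category.assoc, whisker_exchange]

/-- The right fusion operator as a transformation natural in its first variable. -/
def rightFusionNatFst (X : Q.C j) :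
    Q.T b ⋙ tensorRight X ⋙ Q.T a ⟶ Q.T (b ≫ a) ⋙ tensorRight ((Q.T a).obj X) where
  app Y := Q.rightFusion a b Y X
  naturality Y Y' f := by
    change (Q.T a).map ((Q.T b).map f ▷ _) ≫ δ _ _ _ ≫ _ =
      (δ _ _ _ ≫ _) ≫ (Q.T (b ≫ a)).map f ▷ _
    rw [← Functor.OplaxMonoidal.δ_natural_left_assoc, Category.assoc,
      ← comp_whiskerRight, ← comp_whiskerRight, μ_nat]

variable {Q} {a b}

/-- A free composite `c` is needed for the pair `(id, b)`, whose composite `b ≫ 𝟙 j` equals `b` only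
up to a proof. -/
theorem IsLeftHopf.isIso (hQ : Q.IsLeftHopf) {c : k ⟶ i} (h : b ≫ a = c) (X : Q.C j)
    (Y : Q.C k) :
    IsIso (δ (Q.T a) X ((Q.T b).obj Y) ≫ (Q.T a).obj X ◁ (Q.μ a b c h).app Y) := by
  subst h
  exact hQ a b X Y

theorem IsRightHopf.isIso (hQ : Q.IsRightHopf) {c : k ⟶ i} (h : b ≫ a = c) (Y : Q.C k)
    (X : Q.C j) :
    IsIso (δ (Q.T a) ((Q.T b).obj Y) X ≫ (Q.μ a b c h).app Y ▷ (Q.T a).obj X) := by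
  subst h
  exact hQ a b Y X

end Fusion

/-! ### Invertibility of the lifted fusion operators. -/

variable {P : ComonoidalPolyad.{v, u, v', u'} D} [P.IsRExact]

theorem isIso_leftFusion_lift_free (hP : P.IsLeftHopf) {k j i : D} (a : j ⟶ i) (b : k ⟶ j)
    (X : P.C j) (Y : P.C k) :
    IsIso (P.lift.leftFusion a b (freeMod j X : P.Mod j) (freeMod k Y : P.Mod k)) := by
  let g : X ⊗ (P.T b).obj Y ⟶ (modTensor (freeMod j X) (liftObj b (freeMod k Y))).A :=
    (P.η j).app X ⊗ₘ toTensorFree b Y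
  -- The module morphism extending `g` is the fusion operator `H^l_{id,b}(X, Y)` followed by an
  -- isomorphism. On the first factor, `η` cancels against the action of the free module by the unit
  -- axiom.
  have hg : (P.T (𝟙 j)).map g ≫ (modTensor (freeMod j X) (liftObj b (freeMod k Y))).a =
      (δ (P.T (𝟙 j)) X ((P.T b).obj Y) ≫ (P.T (𝟙 j)).obj X ◁
        (P.μ (𝟙 j) b b (Category.comp_id b)).app Y) ≫ (P.T (𝟙 j)).obj X ◁ toTensorFree b Y := by
    change (P.T (𝟙 j)).map ((P.η j).app X ⊗ₘ toTensorFree b Y) ≫ δ (P.T (𝟙 j)) _ _ ≫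
      ((freeMod j X).a ⊗ₘ (liftObj b (freeMod k Y)).a) = _
    rw [← δ_natural_assoc, tensorHom_comp_tensorHom, toTensorFree_act, Category.assoc,
      ← MonoidalCategory.whiskerLeft_comp, ← id_tensorHom]
    congr 2
    exact P.μ_right_unit (𝟙 j) X
  have : IsIso ((P.T (𝟙 j)).map g ≫ (modTensor (freeMod j X) (liftObj b (freeMod k Y))).a) := by
    have := hP.isIso (Category.comp_id b) X Y
    rw [hg]
    infer_instance
  have := isIso_map_comp_π a g
  -- Precomposed with an isomorphism, the underlying morphism of the lifted fusion operator is
  -- `H^l_{a,b}(X, Y)` followed by an isomorphism.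
  have h : ((P.T a).map g ≫ π a (modTensor (freeMod j X) (liftObj b (freeMod k Y)))) ≫
      lift₂ a (freeMod j X) (liftObj b (freeMod k Y)) ≫
      (𝟙 (tensorMod a (freeMod j X)) ⊗ₘ
        liftμApp a b (b ≫ a) rfl (freeMod k Y)) =
      P.leftFusion a b X Y ≫ (toTensorFree a X ⊗ₘ toTensorFree (b ≫ a) Y) := by
    rw [Category.assoc, π_lift₂_assoc, ← δ_natural_assoc, tensorHom_comp_tensorHom,
      tensorHom_comp_tensorHom, Category.comp_id, μ_toTensorFree, leftFusion,
      Category.assoc, whiskerLeft_comp_tensorHom]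
    rfl
  have := hP a b X Y
  have : IsIso (lift₂ a (freeMod j X) (liftObj b (freeMod k Y)) ≫
      (𝟙 (tensorMod a (freeMod j X)) ⊗ₘ
        liftμApp a b (b ≫ a) rfl (freeMod k Y))) := by
    refine (isIso_comp_left_iff
      ((P.T a).map g ≫ π a (modTensor (freeMod j X) (liftObj b (freeMod k Y)))) _).1 ?_
    rw [h]
    infer_instance
  have : IsIso (Algebra.Hom.f (T := P.monad i)
      (P.lift.leftFusion a b (freeMod j X : P.Mod j) (freeMod k Y : P.Mod k))) := this
  exact Monad.algebra_iso_of_iso (P.monad i) _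

theorem IsLeftHopf.lift (hP : P.IsLeftHopf) : P.lift.IsLeftHopf := by
  have hL := P.isRExact_lift
  have := hL.tensorLeft_preserves
  have := hL.tensorRight_preserves
  intro k j i a b M N
  -- The reduction treats one variable at a time: the first stays free while the second becomes
  -- arbitrary, and then the first is released.
  have hN (X : P.C j) (N : P.Mod k) :
      IsIso (P.lift.leftFusion a b (freeMod j X : P.Mod j) N) :=
    isIso_app_of_isIso_app_free (T := P.monad k)
      (P.lift.leftFusionNatSnd a b (freeMod j X : P.Mod j))
      (fun Y => isIso_leftFusion_lift_free hP a b X Y) N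
  exact isIso_app_of_isIso_app_free (T := P.monad j) (P.lift.leftFusionNatFst a b N)
    (fun X => hN X N) M

theorem isIso_rightFusion_lift_free (hP : P.IsRightHopf) {k j i : D} (a : j ⟶ i) (b : k ⟶ j)
    (Y : P.C k) (X : P.C j) :
    IsIso (P.lift.rightFusion a b (freeMod k Y : P.Mod k) (freeMod j X : P.Mod j)) := by
  let g : (P.T b).obj Y ⊗ X ⟶ (modTensor (liftObj b (freeMod k Y)) (freeMod j X)).A :=
    toTensorFree b Y ⊗ₘ (P.η j).app X
  -- As on the left, with `H^r_{id,b}(Y, X)` in place of `H^l_{id,b}(X, Y)`.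
  have hg : (P.T (𝟙 j)).map g ≫ (modTensor (liftObj b (freeMod k Y)) (freeMod j X)).a =
      (δ (P.T (𝟙 j)) ((P.T b).obj Y) X ≫
        (P.μ (𝟙 j) b b (Category.comp_id b)).app Y ▷ (P.T (𝟙 j)).obj X) ≫
          toTensorFree b Y ▷ (P.T (𝟙 j)).obj X := by
    change (P.T (𝟙 j)).map (toTensorFree b Y ⊗ₘ (P.η j).app X) ≫ δ (P.T (𝟙 j)) _ _ ≫
      ((liftObj b (freeMod k Y)).a ⊗ₘ (freeMod j X).a) = _
    rw [← δ_natural_assoc, tensorHom_comp_tensorHom, toTensorFree_act, Category.assoc,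
      ← comp_whiskerRight, ← tensorHom_id]
    congr 2
    exact P.μ_right_unit (𝟙 j) X
  have : IsIso ((P.T (𝟙 j)).map g ≫ (modTensor (liftObj b (freeMod k Y)) (freeMod j X)).a) := by
    have := hP.isIso (Category.comp_id b) Y X
    rw [hg]
    infer_instance
  have := isIso_map_comp_π a g
  have h : ((P.T a).map g ≫ π a (modTensor (liftObj b (freeMod k Y)) (freeMod j X))) ≫
      lift₂ a (liftObj b (freeMod k Y)) (freeMod j X) ≫
      (liftμApp a b (b ≫ a) rfl (freeMod k Y) ⊗ₘ
        𝟙 (tensorMod a (freeMod j X))) =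
      P.rightFusion a b Y X ≫ (toTensorFree (b ≫ a) Y ⊗ₘ toTensorFree a X) := by
    rw [Category.assoc, π_lift₂_assoc, ← δ_natural_assoc, tensorHom_comp_tensorHom,
      tensorHom_comp_tensorHom, Category.comp_id, μ_toTensorFree, rightFusion,
      Category.assoc, whiskerRight_comp_tensorHom]
    rfl
  have := hP a b Y X
  have : IsIso (lift₂ a (liftObj b (freeMod k Y)) (freeMod j X) ≫
      (liftμApp a b (b ≫ a) rfl (freeMod k Y) ⊗ₘ
        𝟙 (tensorMod a (freeMod j X)))) := by
    refine (isIso_comp_left_iff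
      ((P.T a).map g ≫ π a (modTensor (liftObj b (freeMod k Y)) (freeMod j X))) _).1 ?_
    rw [h]
    infer_instance
  have : IsIso (Algebra.Hom.f (T := P.monad i)
      (P.lift.rightFusion a b (freeMod k Y : P.Mod k) (freeMod j X : P.Mod j))) := this
  exact Monad.algebra_iso_of_iso (P.monad i) _

theorem IsRightHopf.lift (hP : P.IsRightHopf) : P.lift.IsRightHopf := by
  have hL := P.isRExact_lift
  have := hL.tensorLeft_preserves
  have := hL.tensorRight_preserves
  intro k j i a b N M
  -- The factor from `P.Mod j`, now on the right of the tensor product, is again the one kept free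
  -- first.
  have hN (X : P.C j) (N : P.Mod k) :
      IsIso (P.lift.rightFusion a b N (freeMod j X : P.Mod j)) :=
    isIso_app_of_isIso_app_free (T := P.monad k)
      (P.lift.rightFusionNatFst a b (freeMod j X : P.Mod j))
      (fun Y => isIso_rightFusion_lift_free hP a b Y X) N
  exact isIso_app_of_isIso_app_free (T := P.monad j) (P.lift.rightFusionNatSnd a b N)
    (fun X => hN X N) M

end ComonoidalPolyad

theorem mainTheorem3 {D : Type u} [Category.{v} D] (T : ComonoidalPolyad.{v, u, v', u'} D)
    [T.IsRExact] :
    (T.IsLeftHopf → T.lift.IsRExact ∧ T.lift.IsLeftHopf) ∧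
    (T.IsRightHopf → T.lift.IsRExact ∧ T.lift.IsRightHopf) ∧
    (T.IsHopf → T.lift.IsRExact ∧ T.lift.IsHopf) :=
  ⟨fun h => ⟨T.isRExact_lift, h.lift⟩, fun h => ⟨T.isRExact_lift, h.lift⟩,
    fun h => ⟨T.isRExact_lift, h.1.lift, h.2.lift⟩⟩
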